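/- All rings are associative with $1\neq 0$, not necessarily commutative. A ring is called local if its non-units form an additive group. For a ring $R$ and $n\ge 1$, let $\mathrm{GL}_n(R)$ be the group of invertible $n\times n$ matrices over $R$; we say that $\mathrm{GL}_n(R)$ admits the inverse-transpose automorphism if, with $x^T$ denoting the entrywise transpose of $x$ (that is, $(x^T)_{ij}=x_{ji}$), the matrix $x^T$ is invertible for every $x\in\mathrm{GL}_n(R)$ and the map $x\mapsto (x^T)^{-1}$ is an automorphism of the group $\mathrm{GL}_n(R)$. Two structures of the same first-order signature are called universally equivalent if they satisfy the same universal sentences, i.e. the same sentences $\forall x_1\dots\forall x_k\,\psi(x_1,\dots,x_k)$ with $\psi$ quantifier-free; groups are regarded as structures in the signature $(\cdot,{}^{-1},1)$ and rings in the signature $(+,\cdot,-,0,1)$. Theorem. Let $R_1$ and $R_2$ be local (not necessarily commutative) rings in which $2$ is invertible, let $n,m\geq 3$, and suppose that the groups $\mathrm{GL}_n(R_1)$ and $\mathrm{GL}_m(R_2)$ both admit the inverse-transpose automorphism. Then the groups $\mathrm{GL}_n(R_1)$ and $\mathrm{GL}_m(R_2)$ are universally equivalent if and only if $n=m$ and the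 rings $R_1$ and $R_2$ are universally equivalent. -/

import Mathlib

/-- The operation symbols of the signature of groups: multiplication, inverse, identity. -/
inductive GroupFunc : ℕ → Type
  | mul : GroupFunc 2
  | inv : GroupFunc 1
  | one : GroupFunc 0

/-- The first-order language of groups; its only relation is equality. -/
def groupLanguage : FirstOrder.Language :=
  { Functions := GroupFunc
    Relations := fun _ => Empty }

/-- A group as a structure for the language of groups. -/
@[reducible]
def groupStructure (G : Type*) [Group G] : groupLanguage.Structure G :=
  { funMap := fun {n} f =>
      match n, f with
      | _, GroupFunc.mul => fun x => x 0 * x 1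
      | _, GroupFunc.inv => fun x => (x 0)⁻¹
      | _, GroupFunc.one => fun _ => 1
    RelMap := fun {_} r => nomatch r }

/-- A ring as a structure for the language of rings, with symbols `+`, `*`, `-`, `0`, `1`. -/
@[reducible]
def ringStructure (R : Type*) [Ring R] : FirstOrder.Language.ring.Structure R :=
  (FirstOrder.Ring.compatibleRingOfRing R).toStructure

/-- Two structures of the same signature are universally equivalent if they satisfy the same
universal sentences `∀ x₁ … ∀ xₖ, ψ` with `ψ` quantifier-free. -/
def UniversallyEquivalent (L : FirstOrder.Language) (M N : Type*)
    [L.Structure M] [L.Structure N] : Prop :=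
  ∀ φ : L.Sentence, FirstOrder.Language.BoundedFormula.IsUniversal φ →
    (FirstOrder.Language.Sentence.Realize M φ ↔ FirstOrder.Language.Sentence.Realize N φ)

/-- Universal equivalence of groups. -/
def GroupsUniversallyEquivalent (G H : Type*) [Group G] [Group H] : Prop :=
  letI := groupStructure G
  letI := groupStructure H
  UniversallyEquivalent groupLanguage G H

/-- Universal equivalence of rings. -/
def RingsUniversallyEquivalent (R S : Type*) [Ring R] [Ring S] : Prop :=
  letI := ringStructure R
  letI := ringStructure S
  UniversallyEquivalent FirstOrder.Language.ring R S

/-- `GL n R` admits the inverse-transpose automorphism: there is an automorphism `φ` of the group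
such that `φ x = (xᵀ)⁻¹` for all `x`. In particular all the transposes `xᵀ` are invertible:
the matrix `xᵀ` is the inverse of `φ x`. -/
def AdmitsInverseTranspose (n : ℕ) (R : Type*) [Ring R] : Prop :=
  ∃ φ : Matrix.GeneralLinearGroup (Fin n) R ≃* Matrix.GeneralLinearGroup (Fin n) R,
    ∀ x : Matrix.GeneralLinearGroup (Fin n) R,
      (((φ x)⁻¹ : Matrix.GeneralLinearGroup (Fin n) R) : Matrix (Fin n) (Fin n) R) =
        (x : Matrix (Fin n) (Fin n) R).transpose

/-!
The argument rests on three observations.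

*Commutativity.* If inverse-transpose is an automorphism then `(x * y)ᵀ = yᵀ * xᵀ` for all
invertible `x` and `y`. For `x = 1 + a e₁₂` and `y = 1 + b e₂₃` this says `a * b = b * a`
(`AdmitsInverseTranspose.mul_comm`), so both rings are commutative.

*Ultrapowers.* The universal theory of `N` holds in `M` if and only if `M` embeds into an ultrapower
of `N` (`exists_embedding_ultrapower`, `realize_of_embedding_ultrapower`). An ultrapower of
`GL n S` is `GL n` of the ultrapower of `S` (`Filter.Germ.generalLinearGroupEquiv`), and ultrapowers
of local rings are local. Hence an embedding of `R` into an ultrapower of `S` gives one of `GL n R`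
into an ultrapower of `GL n S`, which is one half of the theorem. For the other half, it suffices to
show that an embedding `ρ` of `GL n R` into `GL m S`, with `S` local and `2` invertible in both
rings, forces `n ≤ m`, and for `n = m` provides an embedding of `R` into `S`.

*Reconstruction of the ring.* The images of the diagonal sign changes are commuting involutions,
hence simultaneously diagonalizable over the local ring `S` (`exists_basis_hasWeight`). Each
common eigenvector has a weight, the set of the sign changes that negate it. The family of
weights is invariant under permutations and contains a proper non-empty subset, so there are at
least `n` weights and at most `m`. If `n = m`, the weights are all the points or all the complements
of points, so in a suitable basis `ρ` preserves the sign changes up to a common sign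
(`Matrix.GeneralLinearGroup.exists_adaptedToSigns`). The relations of
`1 + a e i j` with the sign changes, and its commuting with `1 + b e i k`, then force
`ρ (1 + a e i j) = 1 + q a e i j + r a e j i` with additive `q` and `r` such that `r a * q b = 0`;
here `2` being invertible in `R` excludes diagonal entries `-1`, as `1 + a e i j` is a square. The
commutator relation makes `q` and `r` multiplicative up to units, so that a unit multiple
of `q 1` is idempotent and `q` is zero or a rescaled ring homomorphism, and likewise `r`
(`IsLocalRing.eq_zero_or_exists_ringHom`). They are not both zero, and if one of them is a rescaled
ring homomorphism, then the other one vanishes; so the former is injective.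
-/

universe u v w w'

/-! ### Universal theories and ultrapowers -/

namespace FirstOrder.Language

open BoundedFormula

variable {L : Language.{u, v}} {M : Type w} {N : Type w'} {α β : Type*}

theorem BoundedFormula.IsQF.restrictFreeVar [DecidableEq α] {n : ℕ} {φ : L.BoundedFormula α n}
    (h : φ.IsQF) (f : φ.freeVarFinset → β) : (φ.restrictFreeVar f).IsQF := by
  induction h with
  | falsum => exact isQF_bot
  | of_isAtomic h =>
    cases h with
    | equal t₁ t₂ => exact (IsAtomic.equal _ _).isQF
    | rel R ts => exact (IsAtomic.rel _ _).isQF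
  | imp _ _ ih₁ ih₂ => exact (ih₁ _).imp (ih₂ _)

theorem BoundedFormula.IsUniversal.alls {n : ℕ} {φ : L.BoundedFormula α n}
    (h : φ.IsUniversal) : φ.alls.IsUniversal := by
  induction n with
  | zero => exact h
  | succ n ih => exact ih h.all

theorem Formula.isUniversal_iAlls [Finite β] {φ : L.Formula (α ⊕ β)} (h : φ.IsQF) :
    (φ.iAlls β).IsUniversal :=
  (IsUniversal.of_isQF (h.relabel _)).alls

theorem Formula.isQF_iInf [Finite β] {φ : β → L.Formula α} (h : ∀ b, (φ b).IsQF) :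
    (Formula.iInf φ).IsQF := by
  have key : ∀ l : List (L.Formula α), (∀ φ ∈ l, φ.IsQF) → (l.foldr (· ⊓ ·) ⊤).IsQF := by
    intro l hl
    induction l with
    | nil => exact IsQF.top
    | cons a l ih =>
      exact (hl a (by simp)).inf (ih fun φ hφ => hl φ (by simp [hφ]))
  refine key _ fun φ hφ => ?_
  obtain ⟨b, -, rfl⟩ := List.mem_map.1 hφ
  exact h b

variable [L.Structure M] [L.Structure N]

/-- If the universal theory of `N` holds in `M`, then every quantifier-free formula with
parameters that holds in `M` has a solution in `N`. -/
theorem exists_realize_of_isQF [Nonempty N]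
    (h : ∀ φ : L.Sentence, φ.IsUniversal → N ⊨ φ → M ⊨ φ) {φ : L.Formula α} (hφ : φ.IsQF)
    {v : α → M} (hv : φ.Realize v) : ∃ w : α → N, φ.Realize w := by
  classical
  by_contra! hN
  let ψ : L.Formula (Empty ⊕ φ.freeVarFinset) :=
    BoundedFormula.restrictFreeVar φ (fun x => Sum.inr x)
  have hψ : ψ.IsQF := hφ.restrictFreeVar _
  have hM := h (ψ.not.iAlls φ.freeVarFinset) (Formula.isUniversal_iAlls hψ.not) ?_
  · rw [Sentence.Realize, Formula.realize_iAlls] at hM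
    refine hM (fun x => v x) ?_
    exact (BoundedFormula.realize_restrictFreeVar (f := fun x => Sum.inr x)
      (v := Sum.elim default fun x : φ.freeVarFinset => v x) v (fun _ => rfl)).2 hv
  · rw [Sentence.Realize, Formula.realize_iAlls]
    intro w hw
    let w' : α → N := fun a =>
      if ha : a ∈ φ.freeVarFinset then w ⟨a, ha⟩ else Classical.arbitrary N
    refine hN w' ((BoundedFormula.realize_restrictFreeVar w' (fun a => ?_)).1 hw)
    simp [w']

/-- If the universal theory of `N` holds in `M`, then `M` embeds into an ultrapower of `N`:
the index set consists of the finite sets of quantifier-free facts about `M`, and the coordinate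
of the embedding at such a set is a solution of those facts in `N`. -/
theorem exists_embedding_ultrapower [Nonempty N]
    (h : ∀ φ : L.Sentence, φ.IsUniversal → N ⊨ φ → M ⊨ φ) :
    ∃ (I : Type (max u v w)) (U : Ultrafilter I),
      Nonempty (M ↪[L] (U : Filter I).Product fun _ => N) := by
  classical
  let Q := {φ : L.Formula M // φ.IsQF ∧ φ.Realize (id : M → M)}
  have hex : ∀ s : Finset Q, ∃ w : M → N, ∀ φ ∈ s, φ.1.Realize w := by
    intro s
    obtain ⟨w, hw⟩ := exists_realize_of_isQF h
      (φ := Formula.iInf fun φ : s => φ.1.1) (Formula.isQF_iInf fun φ => φ.1.2.1)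
      (v := id) (by rw [Formula.realize_iInf]; exact fun φ => φ.1.2.2)
    rw [Formula.realize_iInf] at hw
    exact ⟨w, fun φ hφ => hw ⟨φ, hφ⟩⟩
  choose w hw using hex
  let U : Ultrafilter (Finset Q) := Ultrafilter.of Filter.atTop
  let F : M → (U : Filter (Finset Q)).Product fun _ => N := fun x =>
    ((fun s => w s x : Finset Q → N) : (U : Filter (Finset Q)).Product fun _ => N)
  have hF : ∀ φ : L.Formula M, φ.IsQF → φ.Realize (id : M → M) → φ.Realize F := by
    intro φ hφ hr
    refine (Ultraproduct.realize_formula_cast φ fun x s => w s x).2 ?_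
    refine Filter.Eventually.filter_mono (Ultrafilter.of_le Filter.atTop) ?_
    exact (Filter.eventually_ge_atTop {⟨φ, hφ, hr⟩}).mono fun s hs =>
      hw s ⟨φ, hφ, hr⟩ (hs (Finset.mem_singleton_self _))
  have hF' : ∀ φ : L.Formula M, φ.IsQF → (φ.Realize F ↔ φ.Realize (id : M → M)) := by
    refine fun φ hφ => ⟨fun h1 => ?_, hF φ hφ⟩
    by_contra h2
    exact hF φ.not hφ.not h2 h1
  refine ⟨_, U, ⟨⟨⟨F, fun x y hxy => ?_⟩, fun {n} f x => ?_, fun {n} r x => ?_⟩⟩⟩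
  · have := hF' (Term.equal (Term.var x) (Term.var y)) (IsAtomic.equal _ _).isQF
    simpa [hxy] using this
  · have := hF (Term.equal (Term.var (Structure.funMap f x))
      (Term.func f fun i => Term.var (x i))) (IsAtomic.equal _ _).isQF
    simpa [Function.comp_def] using this
  · have := hF' (Relations.formula r fun i => Term.var (x i)) (IsAtomic.rel _ _).isQF
    simpa [Function.comp_def, Formula.realize_rel] using this

/-- A structure that embeds into an ultrapower of `N` satisfies the universal theory of `N`. -/
theorem realize_of_embedding_ultrapower [Nonempty N] {I : Type*} {U : Ultrafilter I}
    (f : M ↪[L] (U : Filter I).Product fun _ => N) {φ : L.Sentence} (hφ : φ.IsUniversal)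
    (h : N ⊨ φ) : M ⊨ φ := by
  have h1 : ((U : Filter I).Product fun _ => N) ⊨ φ :=
    (Ultraproduct.sentence_realize φ).2 (Filter.Eventually.of_forall fun _ => h)
  refine hφ.realize_embedding f (v := default) (xs := default) ?_
  rw [Sentence.Realize, Formula.Realize] at h1
  convert h1

end FirstOrder.Language

/-! ### Ultrapowers of groups and rings as germs -/

section Germs

open FirstOrder Language Filter

attribute [local instance] groupStructure ringStructure

variable {I : Type*} {U : Ultrafilter I}

-- `Germ U H` and the model-theoretic `Product` are the same quotient; the following lemmas say that
-- their operations agree.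
theorem funMap_ultrapower_group_mul {H : Type*} [Group H] (a b : Germ (U : Filter I) H) :
    (Structure.funMap (L := groupLanguage) (M := (U : Filter I).Product fun _ => H)
      GroupFunc.mul ![a, b] : (U : Filter I).Product fun _ => H) = a * b := by
  induction a using Germ.inductionOn with | _ a
  induction b using Germ.inductionOn with | _ b
  have := Ultraproduct.funMap_cast (L := groupLanguage) (u := U) (M := fun _ => H)
    GroupFunc.mul ![a, b]
  refine Eq.trans ?_ this
  congr 1
  funext i
  fin_cases i <;> rfl

theorem funMap_ultrapower_group_inv {H : Type*} [Group H] (a : Germ (U : Filter I) H) :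
    (Structure.funMap (L := groupLanguage) (M := (U : Filter I).Product fun _ => H)
      GroupFunc.inv ![a] : (U : Filter I).Product fun _ => H) = a⁻¹ := by
  induction a using Germ.inductionOn with | _ a
  have := Ultraproduct.funMap_cast (L := groupLanguage) (u := U) (M := fun _ => H)
    GroupFunc.inv ![a]
  refine Eq.trans ?_ this
  congr 1
  funext i
  fin_cases i; rfl

theorem funMap_ultrapower_group_one {H : Type*} [Group H] :
    (Structure.funMap (L := groupLanguage) (M := (U : Filter I).Product fun _ => H)
      GroupFunc.one ![] : (U : Filter I).Product fun _ => H) = (1 : Germ (U : Filter I) H) := by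
  have := Ultraproduct.funMap_cast (L := groupLanguage) (u := U) (M := fun _ => H)
    GroupFunc.one ![]
  refine Eq.trans ?_ this
  congr 1
  funext i
  exact i.elim0

theorem funMap_ultrapower_ring_add {S : Type*} [Ring S] (a b : Germ (U : Filter I) S) :
    (Structure.funMap (L := Language.ring) (M := (U : Filter I).Product fun _ => S)
      FirstOrder.Ring.addFunc ![a, b] : (U : Filter I).Product fun _ => S) = a + b := by
  induction a using Germ.inductionOn with | _ a
  induction b using Germ.inductionOn with | _ b
  have := Ultraproduct.funMap_cast (L := Language.ring) (u := U) (M := fun _ => S)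
    FirstOrder.Ring.addFunc ![a, b]
  refine Eq.trans ?_ this
  congr 1
  funext i
  fin_cases i <;> rfl

theorem funMap_ultrapower_ring_mul {S : Type*} [Ring S] (a b : Germ (U : Filter I) S) :
    (Structure.funMap (L := Language.ring) (M := (U : Filter I).Product fun _ => S)
      FirstOrder.Ring.mulFunc ![a, b] : (U : Filter I).Product fun _ => S) = a * b := by
  induction a using Germ.inductionOn with | _ a
  induction b using Germ.inductionOn with | _ b
  have := Ultraproduct.funMap_cast (L := Language.ring) (u := U) (M := fun _ => S)
    FirstOrder.Ring.mulFunc ![a, b]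
  refine Eq.trans ?_ this
  congr 1
  funext i
  fin_cases i <;> rfl

theorem funMap_ultrapower_ring_neg {S : Type*} [Ring S] (a : Germ (U : Filter I) S) :
    (Structure.funMap (L := Language.ring) (M := (U : Filter I).Product fun _ => S)
      FirstOrder.Ring.negFunc ![a] : (U : Filter I).Product fun _ => S) = -a := by
  induction a using Germ.inductionOn with | _ a
  have := Ultraproduct.funMap_cast (L := Language.ring) (u := U) (M := fun _ => S)
    FirstOrder.Ring.negFunc ![a]
  refine Eq.trans ?_ this
  congr 1
  funext i
  fin_cases i; rfl

theorem funMap_ultrapower_ring_zero {S : Type*} [Ring S] :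
    (Structure.funMap (L := Language.ring) (M := (U : Filter I).Product fun _ => S)
      FirstOrder.Ring.zeroFunc ![] : (U : Filter I).Product fun _ => S) =
      (0 : Germ (U : Filter I) S) := by
  have := Ultraproduct.funMap_cast (L := Language.ring) (u := U) (M := fun _ => S)
    FirstOrder.Ring.zeroFunc ![]
  refine Eq.trans ?_ this
  congr 1
  funext i
  exact i.elim0

theorem funMap_ultrapower_ring_one {S : Type*} [Ring S] :
    (Structure.funMap (L := Language.ring) (M := (U : Filter I).Product fun _ => S)
      FirstOrder.Ring.oneFunc ![] : (U : Filter I).Product fun _ => S) =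
      (1 : Germ (U : Filter I) S) := by
  have := Ultraproduct.funMap_cast (L := Language.ring) (u := U) (M := fun _ => S)
    FirstOrder.Ring.oneFunc ![]
  refine Eq.trans ?_ this
  congr 1
  funext i
  exact i.elim0

theorem GroupsUniversallyEquivalent.exists_injective_germ {G : Type u} {H : Type v} [Group G] [Group H]
    (h : GroupsUniversallyEquivalent G H) :
    ∃ (I : Type u) (U : Ultrafilter I) (f : G →* Germ (U : Filter I) H),
      Function.Injective f := by
  obtain ⟨I, U, ⟨f⟩⟩ := exists_embedding_ultrapower (L := groupLanguage) (M := G) (N := H)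
    fun φ hφ hH => (h φ hφ).2 hH
  let f' : G → Germ (U : Filter I) H := f
  refine ⟨I, U, MonoidHom.mk' f' fun x y => ?_, f.injective⟩
  have h1 := f.map_fun (GroupFunc.mul : groupLanguage.Functions 2) ![x, y]
  rw [← funMap_ultrapower_group_mul]
  refine h1.trans ?_
  congr 1
  funext i
  fin_cases i <;> rfl

theorem realize_group_of_injective_germ {G H I : Type*} [Group G] [Group H] {U : Ultrafilter I}
    (f : G →* Germ (U : Filter I) H) (hf : Function.Injective f) (φ : groupLanguage.Sentence)
    (hφ : BoundedFormula.IsUniversal φ) (hH : H ⊨ φ) : G ⊨ φ := by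
  let F : G → (U : Filter I).Product fun _ => H := f
  refine realize_of_embedding_ultrapower (U := U) ⟨⟨F, hf⟩, ?_, ?_⟩ hφ hH
  · intro n s x
    cases s
    · refine (f.map_mul (x 0) (x 1)).trans ?_
      rw [← funMap_ultrapower_group_mul]
      congr 1
      funext i
      fin_cases i <;> rfl
    · refine (f.map_inv (x 0)).trans ?_
      rw [← funMap_ultrapower_group_inv]
      congr 1
      funext i
      fin_cases i; rfl
    · refine f.map_one.trans ?_
      rw [← funMap_ultrapower_group_one]
      congr 1
      funext i
      exact i.elim0
  · exact fun r => nomatch r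

theorem groupsUniversallyEquivalent_of_injective_germ {G H I J : Type*} [Group G] [Group H]
    {U : Ultrafilter I} {V : Ultrafilter J}
    (f : G →* Germ (U : Filter I) H) (hf : Function.Injective f)
    (g : H →* Germ (V : Filter J) G) (hg : Function.Injective g) :
    GroupsUniversallyEquivalent G H :=
  fun φ hφ => ⟨realize_group_of_injective_germ g hg φ hφ, realize_group_of_injective_germ f hf φ hφ⟩

theorem RingsUniversallyEquivalent.exists_injective_germ {R : Type u} {S : Type v} [Ring R] [Ring S]
    (h : RingsUniversallyEquivalent R S) :
    ∃ (I : Type u) (U : Ultrafilter I) (f : R →+* Germ (U : Filter I) S),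
      Function.Injective f := by
  obtain ⟨I, U, ⟨f⟩⟩ := exists_embedding_ultrapower (L := Language.ring) (M := R) (N := S)
    fun φ hφ hH => (h φ hφ).2 hH
  let f' : R → Germ (U : Filter I) S := f
  have hmul : ∀ x y, f' (x * y) = f' x * f' y := by
    intro x y
    rw [← funMap_ultrapower_ring_mul]
    refine (f.map_fun FirstOrder.Ring.mulFunc ![x, y]).trans ?_
    congr 1
    funext i
    fin_cases i <;> rfl
  have hadd : ∀ x y, f' (x + y) = f' x + f' y := by
    intro x y
    rw [← funMap_ultrapower_ring_add]
    refine (f.map_fun FirstOrder.Ring.addFunc ![x, y]).trans ?_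
    congr 1
    funext i
    fin_cases i <;> rfl
  have hone : f' 1 = 1 := by
    rw [← funMap_ultrapower_ring_one]
    refine (f.map_fun FirstOrder.Ring.oneFunc ![]).trans ?_
    congr 1
    funext i
    exact i.elim0
  exact ⟨I, U, RingHom.mk' ⟨⟨f', hone⟩, hmul⟩ hadd, f.injective⟩

theorem realize_ring_of_injective_germ {R S I : Type*} [Ring R] [Ring S] {U : Ultrafilter I}
    (f : R →+* Germ (U : Filter I) S) (hf : Function.Injective f)
    (φ : Language.ring.Sentence) (hφ : BoundedFormula.IsUniversal φ) (hS : S ⊨ φ) :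
    R ⊨ φ := by
  let F : R → (U : Filter I).Product fun _ => S := f
  refine realize_of_embedding_ultrapower (U := U) ⟨⟨F, hf⟩, ?_, ?_⟩ hφ hS
  · intro n s x
    cases s
    · refine (f.map_add (x 0) (x 1)).trans ?_
      rw [← funMap_ultrapower_ring_add]
      congr 1
      funext i
      fin_cases i <;> rfl
    · refine (f.map_mul (x 0) (x 1)).trans ?_
      rw [← funMap_ultrapower_ring_mul]
      congr 1
      funext i
      fin_cases i <;> rfl
    · refine (f.map_neg (x 0)).trans ?_
      rw [← funMap_ultrapower_ring_neg]
      congr 1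
      funext i
      fin_cases i; rfl
    · refine f.map_zero.trans ?_
      rw [← funMap_ultrapower_ring_zero]
      congr 1
      funext i
      exact i.elim0
    · refine f.map_one.trans ?_
      rw [← funMap_ultrapower_ring_one]
      congr 1
      funext i
      exact i.elim0
  · exact fun r => nomatch r

theorem ringsUniversallyEquivalent_of_injective_germ {R S I J : Type*} [Ring R] [Ring S]
    {U : Ultrafilter I} {V : Ultrafilter J}
    (f : R →+* Germ (U : Filter I) S) (hf : Function.Injective f)
    (g : S →+* Germ (V : Filter J) R) (hg : Function.Injective g) :
    RingsUniversallyEquivalent R S :=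
  fun φ hφ => ⟨realize_ring_of_injective_germ g hg φ hφ, realize_ring_of_injective_germ f hf φ hφ⟩

end Germs

/-! ### General linear groups of rings of germs -/

namespace Filter.Germ

variable {I : Type*}

/-- The filter has to be an ultrafilter: for a germ `a`, one of `a` and `1 - a` is a unit at almost
all indices. -/
theorem isLocalRing {U : Ultrafilter I} {S : Type*} [CommRing S] [IsLocalRing S] :
    IsLocalRing (Germ (U : Filter I) S) := by
  refine IsLocalRing.of_isUnit_or_isUnit_one_sub_self fun a => ?_
  induction a using Germ.inductionOn with | _ a
  have key : ∀ b : I → S, (∀ᶠ i in (U : Filter I), IsUnit (b i)) →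
      IsUnit (b : Germ (U : Filter I) S) := by
    intro b hb
    refine IsUnit.of_mul_eq_one (((fun i => Ring.inverse (b i) : I → S)) : Germ (U : Filter I) S) ?_
    exact Germ.coe_eq.2 (hb.mono fun i hi => Ring.mul_inverse_cancel _ hi)
  have h : ∀ᶠ i in (U : Filter I), IsUnit (a i) ∨ IsUnit (1 - a i) :=
    Eventually.of_forall fun i => IsLocalRing.isUnit_or_isUnit_one_sub_self (a i)
  exact (Ultrafilter.eventually_or.1 h).imp (key a) (key _)

/-- A germ of matrices, seen as a matrix of germs. -/
def toMatrix {l : Filter I} {S n : Type*} (A : Germ l (Matrix n n S)) : Matrix n n (Germ l S) :=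
  Matrix.of fun i j => A.map fun M => M i j

variable {l : Filter I} {S n : Type*}

theorem toMatrix_injective [Finite n] :
    Function.Injective (toMatrix (l := l) (S := S) (n := n)) := by
  intro A B h
  induction A using Germ.inductionOn with | _ A
  induction B using Germ.inductionOn with | _ B
  have : ∀ i j, ∀ᶠ a in l, A a i j = B a i j := fun i j =>
    Germ.coe_eq.1 (congrFun (congrFun h i) j)
  refine Germ.coe_eq.2 ?_
  filter_upwards [eventually_all.2 fun i => eventually_all.2 (this i)] with a ha
  ext i j
  exact ha i j

theorem toMatrix_surjective : Function.Surjective (toMatrix (l := l) (S := S) (n := n)) := by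
  intro A
  choose a ha using fun i j => Quotient.exists_rep (A i j)
  refine ⟨((fun x => Matrix.of fun i j => a i j x : I → Matrix n n S) : Germ l _), ?_⟩
  ext i j
  exact ha i j

theorem toMatrix_one [CommRing S] [DecidableEq n] :
    toMatrix (1 : Germ l (Matrix n n S)) = 1 := by
  ext i j
  by_cases h : i = j
  · subst h
    rw [Matrix.one_apply_eq]
    exact congrArg _ (funext fun _ => Matrix.one_apply_eq i)
  · rw [Matrix.one_apply_ne h]
    exact congrArg _ (funext fun _ => Matrix.one_apply_ne h)

theorem toMatrix_mul [CommRing S] [Fintype n] (A B : Germ l (Matrix n n S)) :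
    toMatrix (A * B) = toMatrix A * toMatrix B := by
  induction A using Germ.inductionOn with | _ A
  induction B using Germ.inductionOn with | _ B
  ext i j
  rw [Matrix.mul_apply]
  have := map_sum (Germ.coeRingHom l : (I → S) →+* Germ l S)
    (fun k => (fun x => A x i k) * (fun x => B x k j)) Finset.univ
  simp only [map_mul] at this
  refine Eq.trans ?_ this
  refine congrArg (Germ.coeRingHom l : (I → S) →+* Germ l S) (funext fun x => ?_)
  simp [Matrix.mul_apply]

/-- Germs of invertible matrices are the same as invertible matrices of germs: a matrix
of germs that is invertible is represented by a family of matrices that are invertible eventually along the filter. -/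
noncomputable def generalLinearGroupEquiv [CommRing S] [Fintype n] [DecidableEq n] :
    Germ l (Matrix.GeneralLinearGroup n S) ≃* Matrix.GeneralLinearGroup n (Germ l S) := by
  let F : Germ l (Matrix.GeneralLinearGroup n S) →* Matrix n n (Germ l S) :=
    { toFun := fun g => toMatrix (g.map Units.val)
      map_one' := toMatrix_one
      map_mul' := fun g h => by
        rw [← toMatrix_mul]
        induction g using Germ.inductionOn with | _ g
        induction h using Germ.inductionOn with | _ h
        rfl }
  refine MulEquiv.ofBijective F.toHomUnits ⟨fun g h hgh => ?_, fun X => ?_⟩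
  · have h1 := toMatrix_injective (congrArg Units.val hgh)
    induction g using Germ.inductionOn with | _ g
    induction h using Germ.inductionOn with | _ h
    exact Germ.coe_eq.2 ((Germ.coe_eq.1 h1).mono fun i hi => Units.ext hi)
  · classical
    obtain ⟨A, hA⟩ := toMatrix_surjective X.1
    obtain ⟨B, hB⟩ := toMatrix_surjective (X⁻¹).1
    have hAB : A * B = 1 := toMatrix_injective <| by
      rw [toMatrix_mul, hA, hB, toMatrix_one, Units.mul_inv]
    have hBA : B * A = 1 := toMatrix_injective <| by
      rw [toMatrix_mul, hA, hB, toMatrix_one, Units.inv_mul]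
    induction A using Germ.inductionOn with | _ A
    induction B using Germ.inductionOn with | _ B
    have h1 := Germ.coe_eq.1 hAB
    have h2 := Germ.coe_eq.1 hBA
    let g : I → Matrix.GeneralLinearGroup n S := fun i =>
      if h : A i * B i = 1 ∧ B i * A i = 1 then ⟨A i, B i, h.1, h.2⟩ else 1
    refine ⟨(g : Germ l _), Units.ext ?_⟩
    rw [← hA]
    refine congrArg toMatrix (Germ.coe_eq.2 ?_)
    filter_upwards [h1, h2] with i hi hi'
    have : A i * B i = 1 ∧ B i * A i = 1 := ⟨hi, hi'⟩
    simp [g, this]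

/-- An embedding of rings `R → Germ l S` induces an embedding of groups
`GL n R → Germ l (GL n S)`. -/
theorem exists_injective_generalLinearGroup {R : Type*} [CommRing R]
    [CommRing S] [Fintype n] [DecidableEq n] (f : R →+* Germ l S) (hf : Function.Injective f) :
    ∃ F : Matrix.GeneralLinearGroup n R →* Germ l (Matrix.GeneralLinearGroup n S),
      Function.Injective F := by
  refine ⟨generalLinearGroupEquiv.symm.toMonoidHom.comp (Matrix.GeneralLinearGroup.map f),
    generalLinearGroupEquiv.symm.injective.comp fun g h hgh => Units.ext ?_⟩
  ext i j
  exact hf ((Matrix.GeneralLinearGroup.ext_iff _ _).1 hgh i j)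

end Filter.Germ

/-! ### Sign changes, permutation matrices and elementary matrices -/

namespace Matrix.GeneralLinearGroup

variable {ι R : Type*} [Fintype ι] [DecidableEq ι] [CommRing R]

/-- The diagonal matrix with entry `-1` at the place `j` and `1` at all other places. -/
def signFlip (R : Type*) [CommRing R] (j : ι) : GL ι R where
  val := diagonal fun x => if x = j then -1 else 1
  inv := diagonal fun x => if x = j then -1 else 1
  val_inv := by
    rw [diagonal_mul_diagonal, ← diagonal_one]
    congr 1; funext x; split_ifs <;> simp
  inv_val := by
    rw [diagonal_mul_diagonal, ← diagonal_one]
    congr 1; funext x; split_ifs <;> simp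

/-- The permutation matrix that sends the basis vector `e y` to `e (σ y)`. -/
def permutation (R : Type*) [CommRing R] (σ : Equiv.Perm ι) : GL ι R where
  val := of fun x y => if x = σ y then 1 else 0
  inv := of fun x y => if y = σ x then 1 else 0
  val_inv := by
    ext x y
    rw [mul_apply, Finset.sum_eq_single (σ.symm x)]
    · simp [one_apply, eq_comm]
    · intro z _ hz
      have : x ≠ σ z := fun h => hz (by simp [h])
      simp [this]
    · simp
  inv_val := by
    ext x y
    rw [mul_apply, Finset.sum_eq_single (σ x)]
    · simp [one_apply]
    · intro z _ hz
      simp [hz]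
    · simp

/-- The elementary matrix `1 + a e i j`, for `i ≠ j`. -/
def elementary {i j : ι} (hij : i ≠ j) (a : R) : GL ι R where
  val := transvection i j a
  inv := transvection i j (-a)
  val_inv := by rw [transvection_mul_transvection_same _ _ hij]; simp
  inv_val := by rw [transvection_mul_transvection_same _ _ hij]; simp

theorem coe_signFlip_apply (j x y : ι) :
    (signFlip R j : Matrix ι ι R) x y = if x = y then (if x = j then -1 else 1) else 0 := rfl

theorem coe_elementary {i j : ι} (hij : i ≠ j) (a : R) :
    (elementary hij a : Matrix ι ι R) = 1 + single i j a := rfl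

theorem signFlip_mul_self (j : ι) : signFlip R j * signFlip R j = 1 :=
  Units.ext (signFlip R j).val_inv

theorem signFlip_comm (i j : ι) : signFlip R i * signFlip R j = signFlip R j * signFlip R i := by
  refine Units.ext ?_
  change diagonal _ * diagonal _ = diagonal _ * diagonal _
  simp only [diagonal_mul_diagonal, mul_comm]

theorem signFlip_injective [Nontrivial R] (h2 : IsUnit (2 : R)) :
    Function.Injective (signFlip (ι := ι) R) := by
  intro i j h
  by_contra hij
  have h1 := (ext_iff _ _).1 h i i
  simp only [coe_signFlip_apply, if_true, if_neg hij] at h1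
  refine h2.ne_zero ?_
  linear_combination -h1

theorem permutation_mul_signFlip (σ : Equiv.Perm ι) (j : ι) :
    permutation R σ * signFlip R j = signFlip R (σ j) * permutation R σ := by
  refine Units.ext ?_
  change of _ * diagonal _ = diagonal _ * of _
  ext x y
  rw [mul_diagonal, diagonal_mul]
  by_cases h : x = σ y <;> simp [h]

theorem permutation_mul_elementary (σ : Equiv.Perm ι) {i j : ι} (hij : i ≠ j) (a : R) :
    permutation R σ * elementary hij a =
      elementary (σ.injective.ne hij) a * permutation R σ := by
  refine Units.ext ?_
  change of _ * (1 + single i j a) = (1 + single (σ i) (σ j) a) * of _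
  rw [mul_add, add_mul, mul_one, one_mul]
  congr 1
  ext x y
  by_cases hx : x = σ i <;> by_cases hy : y = j
  · subst hx hy; simp
  · subst hx; simp [hy, Ne.symm hy]
  · subst hy; simp [hx]
  · simp [hx, hy]

theorem elementary_mul {i j : ι} (hij : i ≠ j) (a b : R) :
    elementary hij a * elementary hij b = elementary hij (a + b) :=
  Units.ext (transvection_mul_transvection_same _ _ hij a b)

theorem elementary_zero {i j : ι} (hij : i ≠ j) : elementary hij (0 : R) = 1 :=
  Units.ext (transvection_zero i j)

theorem elementary_injective {i j : ι} (hij : i ≠ j) :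
    Function.Injective (elementary hij : R → GL ι R) := by
  intro a b h
  simpa [coe_elementary, one_apply_ne hij] using (ext_iff _ _).1 h i j

theorem elementary_mul_signFlip {i j c : ι} (hij : i ≠ j) (hi : c ≠ i) (hj : c ≠ j) (a : R) :
    elementary hij a * signFlip R c = signFlip R c * elementary hij a := by
  refine Units.ext ?_
  change (1 + single i j a) * diagonal _ = diagonal _ * (1 + single i j a)
  rw [mul_add, add_mul, mul_one, one_mul]
  congr 1
  ext x y
  rw [mul_diagonal, diagonal_mul]
  by_cases hx : i = x <;> by_cases hy : j = y
  · subst hx hy; simp [hi.symm, hj.symm]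
  all_goals simp [hx, hy]

theorem elementary_mul_signFlip_mul {i j : ι} (hij : i ≠ j) (a : R) :
    elementary hij a * signFlip R i * elementary hij a = signFlip R i := by
  have h : elementary hij a * signFlip R i = signFlip R i * elementary hij (-a) := by
    refine Units.ext ?_
    change (1 + single i j a) * diagonal _ = diagonal _ * (1 + single i j (-a))
    rw [mul_add, add_mul, mul_one, one_mul]
    congr 1
    ext x y
    rw [mul_diagonal, diagonal_mul]
    by_cases hx : i = x <;> by_cases hy : j = y
    · subst hx hy; simp [hij.symm]
    all_goals simp [hx, hy]
  rw [h, mul_assoc, elementary_mul, neg_add_cancel, elementary_zero, mul_one]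

theorem elementary_comm {i j k : ι} (hij : i ≠ j) (hik : i ≠ k) (a b : R) :
    elementary hij a * elementary hik b = elementary hik b * elementary hij a := by
  refine Units.ext ?_
  change (1 + single i j a) * (1 + single i k b) = (1 + single i k b) * (1 + single i j a)
  simp only [mul_add, add_mul, mul_one, one_mul, single_mul_single_of_ne _ _ _ _ hij.symm,
    single_mul_single_of_ne _ _ _ _ hik.symm]
  abel

theorem elementary_mul_elementary {i j k : ι} (hij : i ≠ j) (hjk : j ≠ k) (hik : i ≠ k)
    (a b : R) :
    elementary hij a * elementary hjk b =
      elementary hik (a * b) * (elementary hjk b * elementary hij a) := by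
  refine Units.ext ?_
  change (1 + single i j a) * (1 + single j k b) =
    (1 + single i k (a * b)) * ((1 + single j k b) * (1 + single i j a))
  simp only [mul_add, add_mul, mul_one, one_mul, single_mul_single_of_ne _ _ _ _ hik.symm,
    single_mul_single_of_ne _ _ _ _ hjk.symm, single_mul_single_same, add_zero]
  abel

end Matrix.GeneralLinearGroup

/-! ### Representations adapted to the sign changes -/

/-- An additive map that is multiplicative up to a unit `θ` is zero or, after rescaling by `θ`, a
ring homomorphism: `θ * q 1` is an idempotent, hence `0` or `1` in a local ring. -/
theorem IsLocalRing.eq_zero_or_exists_ringHom {R S : Type*} [CommRing R] [CommRing S]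
    [IsLocalRing S] (q : R → S) (θ : S) (hadd : ∀ a b, q (a + b) = q a + q b)
    (hmul : ∀ a b, θ * (q a * q b) = q (a * b)) :
    (∀ a, q a = 0) ∨ (IsUnit (q 1) ∧ ∃ f : R →+* S, ∀ a, f a = θ * q a) := by
  rcases IsLocalRing.isUnit_or_isUnit_one_sub_self (θ * q 1) with h | h
  · have h1 : θ * q 1 = 1 := by
      refine h.mul_left_cancel ?_
      have := hmul 1 1
      rw [mul_one] at this
      linear_combination θ * this
    refine Or.inr ⟨IsUnit.of_mul_eq_one θ (by rw [mul_comm, h1]),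
      RingHom.mk' ⟨⟨fun a => θ * q a, h1⟩, fun a b => ?_⟩ fun a b => ?_, fun a => rfl⟩
    · change θ * q (a * b) = θ * q a * (θ * q b)
      rw [← hmul]; ring
    · change θ * q (a + b) = θ * q a + θ * q b
      rw [hadd]; ring
  · refine Or.inl fun a => ?_
    refine h.mul_right_eq_zero.1 ?_
    have := hmul a 1
    rw [mul_one] at this
    linear_combination -this

namespace Matrix.GeneralLinearGroup

section Diagonal

variable {ι R S : Type*} [Fintype ι] [DecidableEq ι] [CommRing R] [CommRing S]
  {ρ : GL ι R →* Matrix ι ι S} {s : S}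

/-- A matrix representation `ρ` of `GL ι R` over `S` is adapted to the sign changes if it sends
each of them to the corresponding sign change over `S`, up to a common factor `s` with `s * s = 1`.
-/
structure AdaptedToSigns (ρ : GL ι R →* Matrix ι ι S) (s : S) : Prop where
  mul_self : s * s = 1
  map_signFlip : ∀ j, ρ (signFlip R j) = s • (signFlip S j : Matrix ι ι S)

namespace AdaptedToSigns

theorem apply_eq_zero (hρ : AdaptedToSigns ρ s) (h2 : IsUnit (2 : S)) {g : GL ι R} {a b x y : ι}
    (h : g * signFlip R a = signFlip R b * g) (hxy : ¬(y = a ↔ x = b)) : ρ g x y = 0 := by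
  have h1 := congrArg (s • ρ ·) h
  simp only [map_mul, hρ.map_signFlip, Matrix.mul_smul, Matrix.smul_mul, smul_smul, hρ.mul_self,
    one_smul] at h1
  have h3 := Matrix.ext_iff.2 h1 x y
  change (ρ g * diagonal _ : Matrix ι ι S) x y = (diagonal _ * ρ g : Matrix ι ι S) x y at h3
  rw [mul_diagonal, diagonal_mul] at h3
  refine h2.mul_right_eq_zero.1 ?_
  by_cases hy : y = a <;> by_cases hx : x = b <;> simp only [hx, hy, if_true, if_false] at h3 hxy ⊢
  · simp at hxy
  · linear_combination -h3
  · linear_combination h3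
  · simp at hxy

theorem permutation_apply (hρ : AdaptedToSigns ρ s) (h2 : IsUnit (2 : S)) (σ : Equiv.Perm ι)
    {x y : ι} (h : x ≠ σ y) : ρ (permutation R σ) x y = 0 :=
  hρ.apply_eq_zero h2 (permutation_mul_signFlip σ y) (by simp [h])

theorem isUnit_permutation_apply (hρ : AdaptedToSigns ρ s) (h2 : IsUnit (2 : S))
    (σ : Equiv.Perm ι) (y : ι) : IsUnit (ρ (permutation R σ) (σ y) y) := by
  have h : (ρ (permutation R σ) * ρ (permutation R σ)⁻¹) (σ y) (σ y) = 1 := by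
    rw [← map_mul, mul_inv_cancel, map_one, one_apply_eq]
  rw [mul_apply, Finset.sum_eq_single y] at h
  · exact IsUnit.of_mul_eq_one _ h
  · intro z _ hz
    rw [hρ.permutation_apply h2 σ (by simpa using hz.symm), zero_mul]
  · simp

/-- Conjugating by a permutation matrix permutes the entries of the image of an elementary matrix,
up to units that depend only on the permutation and the entry. -/
theorem exists_unit_elementary (hρ : AdaptedToSigns ρ s) (h2 : IsUnit (2 : S))
    (σ : Equiv.Perm ι) (x y : ι) : ∃ u : Sˣ, ∀ (i j : ι) (hij : i ≠ j) (a : R),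
      ρ (elementary (σ.injective.ne hij) a) (σ x) (σ y) = u * ρ (elementary hij a) x y := by
  obtain ⟨u, hu⟩ := hρ.isUnit_permutation_apply h2 σ x
  obtain ⟨v, hv⟩ := hρ.isUnit_permutation_apply h2 σ y
  refine ⟨v⁻¹ * u, fun i j hij a => ?_⟩
  have h := congrArg (ρ · (σ x) y) (permutation_mul_elementary σ hij a)
  simp only [map_mul, mul_apply] at h
  rw [Finset.sum_eq_single x, Finset.sum_eq_single (σ y), ← hu, ← hv] at h
  · rw [Units.val_mul, mul_assoc, h, mul_comm _ (v : S), Units.inv_mul_cancel_left]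
  · intro z _ hz
    rw [hρ.permutation_apply h2 σ hz, mul_zero]
  · simp
  · intro z _ hz
    rw [hρ.permutation_apply h2 σ (by simpa using hz.symm), zero_mul]
  · simp

theorem elementary_apply_eq_zero (hρ : AdaptedToSigns ρ s) (h2 : IsUnit (2 : S)) {i j : ι}
    (hij : i ≠ j) (a : R) {x y : ι} (hxy : x ≠ y) (h : ¬((x = i ∨ x = j) ∧ (y = i ∨ y = j))) :
    ρ (elementary hij a) x y = 0 := by
  by_cases hx : x = i ∨ x = j
  · have hy : ¬(y = i ∨ y = j) := fun hy => h ⟨hx, hy⟩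
    push Not at hy
    exact hρ.apply_eq_zero h2 (elementary_mul_signFlip hij hy.1 hy.2 a) (by simp [hxy])
  · push Not at hx
    exact hρ.apply_eq_zero h2 (elementary_mul_signFlip hij hx.1 hx.2 a) (by simp [hxy.symm])

/-- The images of `1 + a e i j` and `1 + b e i k` commute, which forces the product of a lower and
an upper entry to vanish. -/
theorem elementary_apply_mul_apply (hρ : AdaptedToSigns ρ s) (h2 : IsUnit (2 : S)) {i j k : ι}
    (hij : i ≠ j) (hik : i ≠ k) (hjk : j ≠ k) (a b : R) :
    ρ (elementary hij a) j i * ρ (elementary hij b) i j = 0 := by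
  obtain ⟨u, hu⟩ := hρ.exists_unit_elementary h2 (Equiv.swap j k) i j
  have hi : Equiv.swap j k i = i := Equiv.swap_apply_of_ne_of_ne hij hik
  have hY : ρ (elementary hik b) i k = u * ρ (elementary hij b) i j := by
    rw [← hu]
    simp only [hi, Equiv.swap_apply_left]
  have h := congrArg (ρ · j k) (elementary_comm hij hik a b)
  simp only [map_mul, mul_apply] at h
  rw [Finset.sum_eq_single i, Finset.sum_eq_single j, hY,
    hρ.elementary_apply_eq_zero h2 hij a hjk (by simp [hik.symm, hjk.symm]), mul_zero,
    mul_left_comm] at h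
  · exact u.isUnit.mul_right_eq_zero.1 h
  · intro z _ hz
    rw [hρ.elementary_apply_eq_zero h2 hik b hz.symm (by simp [hij.symm, hjk]), zero_mul]
  · simp
  · intro z _ hz
    by_cases hzk : z = k
    · subst hzk
      rw [hρ.elementary_apply_eq_zero h2 hij a hjk (by simp [hik.symm, hjk.symm]), zero_mul]
    · rw [hρ.elementary_apply_eq_zero h2 hik b hzk (by simp [hz, hzk]), mul_zero]
  · simp

/-- The diagonal entries square to `1` because the sign change at `i` inverts `1 + a e i j`. -/
theorem elementary_apply_self_mul_self (hρ : AdaptedToSigns ρ s) (h2 : IsUnit (2 : S)) {i j k : ι}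
    (hij : i ≠ j) (hik : i ≠ k) (hjk : j ≠ k) (a : R) (x : ι) :
    ρ (elementary hij a) x x * ρ (elementary hij a) x x = 1 := by
  have h := congrArg (s • ρ ·) (elementary_mul_signFlip_mul hij a)
  simp only [map_mul, hρ.map_signFlip, Matrix.mul_smul, Matrix.smul_mul, smul_smul, hρ.mul_self,
    one_smul] at h
  replace h := Matrix.ext_iff.2 h x x
  change (ρ _ * diagonal _ * ρ _ : Matrix ι ι S) x x = (diagonal _ : Matrix ι ι S) x x at h
  have h0 := hρ.elementary_apply_mul_apply h2 hij hik hjk a a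
  rw [mul_apply, diagonal_apply_eq] at h
  simp only [mul_diagonal] at h
  by_cases hx : x = i ∨ x = j
  · rw [Finset.sum_eq_add i j hij (fun z _ hz => by
      rw [hρ.elementary_apply_eq_zero h2 hij a (x := x) (y := z)
        (by rintro rfl; tauto) (by tauto)]; simp) (by simp) (by simp)] at h
    rcases hx with rfl | rfl
    · simp only [if_true, hij.symm, if_false] at h
      linear_combination -h + h0
    · simp only [if_true, hij.symm, if_false] at h
      linear_combination h + h0
  · rw [Finset.sum_eq_single x (fun z _ hz => by
      rw [hρ.elementary_apply_eq_zero h2 hij a hz.symm (by tauto)]; simp) (by simp)] at h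
    have : x ≠ i := by tauto
    simpa [this] using h

/-- The image of `1 + a e i j` differs from the identity only at the places `(i, j)` and
`(j, i)`. The diagonal entries are `1` because `1 + a e i j` is a square. -/
theorem map_elementary (hρ : AdaptedToSigns ρ s) (h2R : IsUnit (2 : R)) (h2 : IsUnit (2 : S))
    {i j k : ι} (hij : i ≠ j) (hik : i ≠ k) (hjk : j ≠ k) (a : R) :
    ρ (elementary hij a) =
      1 + single i j (ρ (elementary hij a) i j) + single j i (ρ (elementary hij a) j i) := by
  have hdiag : ∀ x, ρ (elementary hij a) x x = 1 := by
    intro x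
    obtain ⟨c, hc⟩ := h2R.exists_right_inv
    have ha : elementary hij a = elementary hij (c * a) * elementary hij (c * a) := by
      rw [elementary_mul]; congr 1; linear_combination -a * hc
    rw [ha, map_mul, mul_apply, Finset.sum_eq_single x,
      hρ.elementary_apply_self_mul_self h2 hij hik hjk]
    · intro z _ hz
      by_cases h : (x = i ∨ x = j) ∧ (z = i ∨ z = j)
      · have h0 := hρ.elementary_apply_mul_apply h2 hij hik hjk (c * a) (c * a)
        obtain ⟨rfl | rfl, rfl | rfl⟩ := h
        · exact absurd rfl hz
        · rw [mul_comm, h0]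
        · exact h0
        · exact absurd rfl hz
      · rw [hρ.elementary_apply_eq_zero h2 hij _ hz.symm h, zero_mul]
    · simp
  ext x y
  simp only [add_apply, one_apply, single_apply]
  by_cases hxy : x = y
  · subst hxy
    have h1 : ¬(i = x ∧ j = x) := fun h => hij (h.1.trans h.2.symm)
    have h3 : ¬(j = x ∧ i = x) := fun h => h1 h.symm
    simp [hdiag, h1, h3]
  · rw [if_neg hxy]
    by_cases h : (x = i ∨ x = j) ∧ (y = i ∨ y = j)
    · obtain ⟨rfl | rfl, rfl | rfl⟩ := h
      · exact absurd rfl hxy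
      · simp [hij.symm]
      · simp [hij]
      · exact absurd rfl hxy
    · have h1 : ¬(i = x ∧ j = y) := by rintro ⟨rfl, rfl⟩; simp at h
      have h3 : ¬(j = x ∧ i = y) := by rintro ⟨rfl, rfl⟩; simp at h
      rw [hρ.elementary_apply_eq_zero h2 hij a hxy h]
      simp [h1, h3]

/-- The commutator relation of elementary matrices, read off at the two entries that may be
non-trivial. -/
theorem elementary_mul_entries (hρ : AdaptedToSigns ρ s) (h2R : IsUnit (2 : R))
    (h2 : IsUnit (2 : S)) {i j k : ι} (hij : i ≠ j) (hik : i ≠ k) (hjk : j ≠ k) (a b : R) :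
    ρ (elementary hij a) i j * ρ (elementary hjk b) j k = ρ (elementary hik (a * b)) i k ∧
      ρ (elementary hij a) j i * ρ (elementary hjk b) k j = -ρ (elementary hik (a * b)) k i := by
  have h := congrArg ρ (elementary_mul_elementary hij hjk hik a b)
  simp only [map_mul] at h
  rw [hρ.map_elementary h2R h2 hij hik hjk a, hρ.map_elementary h2R h2 hjk hij.symm hik.symm b,
    hρ.map_elementary h2R h2 hik hij hjk.symm (a * b)] at h
  have h1 := Matrix.ext_iff.2 h i k
  have h3 := Matrix.ext_iff.2 h k i
  simp [mul_add, add_mul, hij, hik, hjk, hij.symm, hik.symm, hjk.symm] at h1 h3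
  constructor
  · linear_combination h1
  · linear_combination -h3

end AdaptedToSigns

end Diagonal

/-- An injective representation of `GL ι R` over a local ring `S` that is adapted to the sign
changes yields an embedding of `R` into `S`: one of the two families of entries, at `(i, j)` or at
`(j, i)`, of the images of `1 + a e i j` is a rescaled ring homomorphism. -/
theorem AdaptedToSigns.exists_injective_ringHom {ι R S : Type*} [Fintype ι] [DecidableEq ι]
    [CommRing R] [Nontrivial R] [CommRing S] [IsLocalRing S] {ρ : GL ι R →* Matrix ι ι S} {s : S}
    (hρ : AdaptedToSigns ρ s) (hinj : Function.Injective ρ) (h2R : IsUnit (2 : R))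
    (h2 : IsUnit (2 : S)) {i j k : ι} (hij : i ≠ j) (hik : i ≠ k) (hjk : j ≠ k) :
    ∃ f : R →+* S, Function.Injective f := by
  let q : R → S := fun a => ρ (elementary hij a) i j
  let r : R → S := fun a => ρ (elementary hij a) j i
  have hX : ∀ a, ρ (elementary hij a) = 1 + single i j (q a) + single j i (r a) :=
    hρ.map_elementary h2R h2 hij hik hjk
  have hrq : ∀ a b, r a * q b = 0 := hρ.elementary_apply_mul_apply h2 hij hik hjk
  have hadd : ∀ a b, q (a + b) = q a + q b ∧ r (a + b) = r a + r b := by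
    intro a b
    have h := congrArg ρ (elementary_mul hij a b)
    rw [map_mul, hX, hX, hX] at h
    have h1 := Matrix.ext_iff.2 h i j
    have h3 := Matrix.ext_iff.2 h j i
    simp [mul_add, add_mul, hij, hij.symm] at h1 h3
    exact ⟨by linear_combination -h1, by linear_combination -h3⟩
  have hinj' : ∀ a, q a = 0 → r a = 0 → a = 0 := by
    intro a hq hr
    refine elementary_injective hij (hinj ?_)
    rw [hX, hq, hr, elementary_zero, map_one]
    simp
  -- The cycle `i ↦ j ↦ k ↦ i` and the transposition of `j` and `k` carry the place `(i, j)` to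
  -- `(j, k)` and to `(i, k)`.
  let σ : Equiv.Perm ι := Equiv.swap i j * Equiv.swap j k
  have hσi : σ i = j := by
    simp [σ, Equiv.swap_apply_of_ne_of_ne hij hik]
  have hσj : σ j = k := by
    simp [σ, Equiv.swap_apply_of_ne_of_ne hik.symm hjk.symm]
  let τ : Equiv.Perm ι := Equiv.swap j k
  have hτi : τ i = i := Equiv.swap_apply_of_ne_of_ne hij hik
  have hτj : τ j = k := Equiv.swap_apply_left j k
  obtain ⟨μ, hμ⟩ := hρ.exists_unit_elementary h2 σ i j
  obtain ⟨ν, hν⟩ := hρ.exists_unit_elementary h2 σ j i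
  obtain ⟨ξ, hξ⟩ := hρ.exists_unit_elementary h2 τ i j
  obtain ⟨κ, hκ⟩ := hρ.exists_unit_elementary h2 τ j i
  replace hμ := hμ i j hij
  replace hν := hν i j hij
  replace hξ := hξ i j hij
  replace hκ := hκ i j hij
  simp only [hσi, hσj, hτi, hτj] at hμ hν hξ hκ
  have hcomm := hρ.elementary_mul_entries h2R h2 hij hik hjk
  have hq : ∀ a b, (↑ξ⁻¹ * μ : S) * (q a * q b) = q (a * b) := by
    intro a b
    have := (hcomm a b).1
    rw [hμ, hξ] at this
    refine ξ.isUnit.mul_left_cancel (Eq.trans ?_ this)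
    rw [mul_assoc, Units.mul_inv_cancel_left]
    ring
  have hr : ∀ a b, (-↑κ⁻¹ * ν : S) * (r a * r b) = r (a * b) := by
    intro a b
    have := (hcomm a b).2
    rw [hν, hκ] at this
    refine κ.isUnit.mul_left_cancel ?_
    have h1 : (κ : S) * ↑κ⁻¹ = 1 := κ.mul_inv
    linear_combination -this - ν * r a * r b * h1
  rcases IsLocalRing.eq_zero_or_exists_ringHom q _ (fun a b => (hadd a b).1) hq with
    hq0 | ⟨hu, f, hf⟩
  · rcases IsLocalRing.eq_zero_or_exists_ringHom r _ (fun a b => (hadd a b).2) hr with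
      hr0 | ⟨hu, f, hf⟩
    · exact absurd (hinj' 1 (hq0 1) (hr0 1)) one_ne_zero
    · refine ⟨f, (injective_iff_map_eq_zero f).2 fun a ha => hinj' a (hq0 a) ?_⟩
      rw [hf, mul_assoc, neg_mul, neg_eq_zero, κ⁻¹.isUnit.mul_right_eq_zero,
        ν.isUnit.mul_right_eq_zero] at ha
      exact ha
  · refine ⟨f, (injective_iff_map_eq_zero f).2 fun a ha => hinj' a ?_ ?_⟩
    · rw [hf, mul_assoc, ξ⁻¹.isUnit.mul_right_eq_zero, μ.isUnit.mul_right_eq_zero] at ha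
      exact ha
    · exact hu.mul_left_eq_zero.1 (hrq a 1)

end Matrix.GeneralLinearGroup

/-! ### Permutation-invariant families of subsets -/

theorem Nat.lt_choose_of_two_le {N k : ℕ} (hk : 2 ≤ k) (hN : k + 2 ≤ N) : N < N.choose k := by
  induction N generalizing k with
  | zero => omega
  | succ N ih =>
    obtain ⟨k, rfl⟩ : ∃ l, k = l + 1 := ⟨k - 1, by omega⟩
    rw [Nat.choose_succ_succ']
    rcases Nat.lt_or_ge N (k + 1 + 2) with h | h
    · have hN' : N = k + 2 := by omega
      subst hN'
      have h1 : (k + 2).choose (k + 1) = k + 2 := Nat.choose_succ_self_right (k + 1)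
      have h3 : k + 2 ≤ (k + 2).choose k := by
        rcases Nat.lt_or_ge k 2 with h4 | h4
        · have : k = 1 := by omega
          subst this; decide
        · exact (ih h4 le_rfl).le
      omega
    · have h1 := ih hk h
      have h3 : 0 < N.choose k := Nat.choose_pos (by omega)
      omega

namespace Finset

variable {ι : Type*} [Fintype ι] [DecidableEq ι]

theorem exists_perm_map_eq {A B : Finset ι} (h : A.card = B.card) :
    ∃ σ : Equiv.Perm ι, A.map σ.toEmbedding = B := by
  let e : {x // x ∈ A} ≃ {x // x ∈ B} := Finset.equivOfCardEq h
  refine ⟨e.extendSubtype, Finset.eq_of_subset_of_card_le (fun x hx => ?_) (by simp [h])⟩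
  obtain ⟨y, hy, rfl⟩ := Finset.mem_map.1 hx
  exact e.extendSubtype_mem y hy

/-- A permutation-invariant family of subsets that contains a proper non-empty subset has at
least as many members as there are points, and if it has no more than that, then it contains all
points or all complements of points. -/
theorem card_le_of_perm_invariant (W : Finset (Finset ι))
    (hW : ∀ A ∈ W, ∀ σ : Equiv.Perm ι, A.map σ.toEmbedding ∈ W) {A : Finset ι} (hA : A ∈ W)
    {x y : ι} (hx : x ∈ A) (hy : y ∉ A) :
    Fintype.card ι ≤ W.card ∧
      (W.card ≤ Fintype.card ι → (∀ i, {i} ∈ W) ∨ (∀ i, {i}ᶜ ∈ W)) := by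
  have hsub : powersetCard A.card univ ⊆ W := by
    intro B hB
    obtain ⟨σ, rfl⟩ := exists_perm_map_eq (mem_powersetCard.1 hB).2.symm
    exact hW A hA σ
  have hmem : ∀ B : Finset ι, B.card = A.card → B ∈ W := fun B hB =>
    hsub (mem_powersetCard.2 ⟨subset_univ B, hB⟩)
  have hcard := card_le_card hsub
  rw [card_powersetCard, card_univ] at hcard
  have h1 : 1 ≤ A.card := card_pos.2 ⟨x, hx⟩
  have h2 : A.card < Fintype.card ι := card_lt_univ_of_notMem hy
  rcases Nat.lt_or_ge 1 A.card with h3 | h3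
  · rcases Nat.lt_or_ge (A.card + 1) (Fintype.card ι) with h4 | h4
    · have := Nat.lt_choose_of_two_le h3 h4
      exact ⟨by omega, fun h => by omega⟩
    · have h5 : Fintype.card ι = A.card + 1 := by omega
      rw [h5, Nat.choose_succ_self_right] at hcard
      refine ⟨by omega, fun _ => Or.inr fun i => hmem _ ?_⟩
      rw [card_compl, card_singleton]
      omega
  · have h5 : A.card = 1 := by omega
    rw [h5, Nat.choose_one_right] at hcard
    exact ⟨hcard, fun _ => Or.inl fun i => hmem _ (by rw [card_singleton, h5])⟩

end Finset

/-! ### Commuting involutions and their weights -/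

section Involutions

open Module

variable {ι S M : Type*} [CommRing S] [AddCommGroup M] [Module S M]

/-- Commuting involutions of a module over a ring in which `2` is invertible: the common
eigenvectors with eigenvalues `1` and `-1` span the module, since `v` is the mean of `v + g v`
and `v - g v`. -/
theorem span_common_eigenvectors_eq_top (h2 : IsUnit (2 : S)) (g : ι → End S M)
    (hinv : ∀ j, g j * g j = 1) (hcomm : ∀ i j, g i * g j = g j * g i) (T : Finset ι) :
    Submodule.span S {v : M | ∀ j ∈ T, g j v = v ∨ g j v = -v} = ⊤ := by
  classical
  induction T using Finset.induction_on with
  | empty => simp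
  | insert a T _ ih =>
    rw [eq_top_iff, ← ih, Submodule.span_le]
    intro v hv
    have hgg : g a (g a v) = v := LinearMap.congr_fun (hinv a) v
    have hga : ∀ j, g j (g a v) = g a (g j v) := fun j => LinearMap.congr_fun (hcomm j a) v
    have hp : v + g a v ∈ {v : M | ∀ j ∈ insert a T, g j v = v ∨ g j v = -v} := by
      intro j hj
      rcases Finset.mem_insert.1 hj with rfl | hj
      · left; rw [map_add, hgg, add_comm]
      · rcases hv j hj with h | h
        · left; rw [map_add, hga, h]
        · right; rw [map_add, hga, h, map_neg]; abel
    have hm : v - g a v ∈ {v : M | ∀ j ∈ insert a T, g j v = v ∨ g j v = -v} := by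
      intro j hj
      rcases Finset.mem_insert.1 hj with rfl | hj
      · right; rw [map_sub, hgg]; abel
      · rcases hv j hj with h | h
        · left; rw [map_sub, hga, h]
        · right; rw [map_sub, hga, h, map_neg]; abel
    obtain ⟨c, hc⟩ := h2.exists_right_inv
    have hsum : v = c • ((v + g a v) + (v - g a v)) := by
      have : (v + g a v) + (v - g a v) = (2 : S) • v := by rw [two_smul]; abel
      rw [this, smul_smul, mul_comm, hc, one_smul]
    rw [hsum]
    exact Submodule.smul_mem _ _ (Submodule.add_mem _ (Submodule.subset_span hp)
      (Submodule.subset_span hm))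

/-- The vector `v` has weight `A` for the family `g` of involutions if the involutions indexed by
`A` negate it and the others fix it. -/
def HasWeight [DecidableEq ι] (g : ι → End S M) (A : Finset ι) (v : M) : Prop :=
  ∀ j, g j v = (if j ∈ A then -1 else 1 : S) • v

variable [DecidableEq ι]

/-- Over a local ring in which `2` is invertible, commuting involutions of a free module are
simultaneously diagonalizable. -/
theorem exists_basis_hasWeight [Fintype ι] {κ : Type*} [Fintype κ] [IsLocalRing S] (h2 : IsUnit (2 : S))
    (g : ι → End S (κ → S)) (hinv : ∀ j, g j * g j = 1)
    (hcomm : ∀ i j, g i * g j = g j * g i) :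
    ∃ (b : Basis κ S (κ → S)) (A : κ → Finset ι), ∀ i, HasWeight g (A i) (b i) := by
  have hspan := span_common_eigenvectors_eq_top h2 g hinv hcomm Finset.univ
  obtain ⟨κ', a, b, hb⟩ := Module.exists_basis_of_span_of_flat (R := S) (M := κ → S)
    (fun v : {v : κ → S | ∀ j ∈ Finset.univ, g j v = v ∨ g j v = -v} => (v : κ → S))
    (by rw [Subtype.range_coe, hspan])
  classical
  let A : κ' → Finset ι := fun k => Finset.univ.filter fun j => g j (b k) ≠ b k
  have hA : ∀ k, HasWeight g (A k) (b k) := by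
    intro k j
    have hk : g j (b k) = b k ∨ g j (b k) = -b k := by
      rw [hb]; exact (a k).2 j (Finset.mem_univ j)
    by_cases h : g j (b k) = b k
    · simp [A, h]
    · simpa [A, h] using hk
  let e := b.indexEquiv (Pi.basisFun S κ)
  refine ⟨b.reindex e, fun i => A (e.symm i), fun i => ?_⟩
  rw [Basis.reindex_apply]
  exact hA _

/-- Every weight occurs in a given basis of weight vectors, as weights are determined by signs
and `1 ≠ -1`. -/
theorem HasWeight.mem_range {κ : Type*} [Fintype κ] [Nontrivial S] (h2 : IsUnit (2 : S))
    {g : ι → End S M} {b : Basis κ S M} {A : κ → Finset ι} (hb : ∀ i, HasWeight g (A i) (b i))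
    {B : Finset ι} {v : M} (hv : HasWeight g B v) (hv0 : v ≠ 0) : B ∈ Set.range A := by
  obtain ⟨i, hi⟩ : ∃ i, b.repr v i ≠ 0 := by
    by_contra! h
    exact hv0 (b.repr.map_eq_zero_iff.1 (Finsupp.ext h))
  refine ⟨i, Finset.ext fun j => ?_⟩
  have h1 : b.repr (g j v) i = (if j ∈ A i then -1 else 1) * b.repr v i := by
    conv_lhs => rw [← b.sum_repr v]
    simp only [map_sum, map_smul, hb _ j, Finsupp.coe_finsetSum, Finset.sum_apply,
      Finsupp.smul_apply, b.repr_self, smul_eq_mul]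
    rw [Finset.sum_eq_single i]
    · rw [Finsupp.single_eq_same]; ring
    · intro k _ hk
      rw [Finsupp.single_eq_of_ne (by tauto)]; simp
    · simp
  rw [hv j, map_smul, Finsupp.smul_apply, smul_eq_mul] at h1
  by_contra hne
  refine hi (h2.mul_right_eq_zero.1 ?_)
  by_cases hA : j ∈ A i <;> by_cases hB : j ∈ B <;> simp only [hA, hB, if_true, if_false] at h1 hne
  · simp at hne
  · linear_combination h1
  · linear_combination -h1
  · simp at hne

end Involutions

/-! ### Embeddings of general linear groups -/

namespace Matrix.GeneralLinearGroup

open _root_.Module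

/-- An embedding of general linear groups does not decrease the size of the matrices, and if the
sizes agree, then after a change of basis and a relabelling of the basis it is adapted to the sign
changes. The weights of the commuting images of the sign changes form a permutation-invariant
family of subsets. -/
theorem exists_adaptedToSigns {ι κ R S : Type*} [Fintype ι] [DecidableEq ι] [Fintype κ]
    [DecidableEq κ] [CommRing R] [Nontrivial R] [CommRing S] [IsLocalRing S]
    (h2R : IsUnit (2 : R)) (h2 : IsUnit (2 : S)) {x y : ι} (hxy : x ≠ y)
    (ρ : GL ι R →* GL κ S) (hρ : Function.Injective ρ) :
    Fintype.card ι ≤ Fintype.card κ ∧ (Fintype.card κ = Fintype.card ι →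
      ∃ (ρ' : GL ι R →* Matrix ι ι S) (s : S), Function.Injective ρ' ∧ AdaptedToSigns ρ' s) := by
  classical
  let Φ : GL ι R →* End S (κ → S) :=
    ((Matrix.toLinAlgEquiv' : Matrix κ κ S ≃ₐ[S] End S (κ → S)) : Matrix κ κ S →* _).comp
      ((Units.coeHom _).comp ρ)
  have hΦ : Function.Injective Φ :=
    Matrix.toLinAlgEquiv'.injective.comp (Units.val_injective.comp hρ)
  let g : ι → End S (κ → S) := fun j => Φ (signFlip R j)
  obtain ⟨b, A, hb⟩ := exists_basis_hasWeight h2 g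
    (fun j => by rw [← map_mul, signFlip_mul_self, map_one])
    (fun i j => by rw [← map_mul, signFlip_comm, map_mul])
  let W : Finset (Finset ι) := Finset.univ.filter fun B => ∃ v, v ≠ 0 ∧ HasWeight g B v
  have hWA : W ⊆ Finset.univ.image A := by
    intro B hB
    obtain ⟨v, hv0, hv⟩ := (Finset.mem_filter.1 hB).2
    obtain ⟨k, rfl⟩ := hv.mem_range h2 hb hv0
    exact Finset.mem_image_of_mem A (Finset.mem_univ k)
  have hAW : ∀ k, A k ∈ W := fun k =>
    Finset.mem_filter.2 ⟨Finset.mem_univ _, b k, b.ne_zero k, hb k⟩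
  have hWcard : W.card ≤ Fintype.card κ :=
    (Finset.card_le_card hWA).trans Finset.card_image_le
  have hWinv : ∀ B ∈ W, ∀ σ : Equiv.Perm ι, B.map σ.toEmbedding ∈ W := by
    intro B hB σ
    obtain ⟨v, hv0, hv⟩ := (Finset.mem_filter.1 hB).2
    refine Finset.mem_filter.2 ⟨Finset.mem_univ _, Φ (permutation R σ) v, fun h0 => hv0 ?_,
      fun j => ?_⟩
    · have h1 : Φ (permutation R σ)⁻¹ (Φ (permutation R σ) v) = v := by
        rw [← Module.End.mul_apply, ← map_mul, inv_mul_cancel, map_one, Module.End.one_apply]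
      rw [← h1, h0, map_zero]
    · have h1 := congrArg Φ (permutation_mul_signFlip (R := R) σ (σ.symm j))
      rw [map_mul, map_mul, Equiv.apply_symm_apply] at h1
      have h3 := LinearMap.congr_fun h1 v
      rw [Module.End.mul_apply, Module.End.mul_apply] at h3
      change g j _ = _
      rw [← h3]
      change Φ _ (g (σ.symm j) v) = _
      rw [hv, map_smul]
      simp [Finset.mem_map_equiv]
  have hne : ∃ k x y, x ∈ A k ∧ y ∉ A k := by
    by_contra! h
    refine hxy (signFlip_injective h2R (hΦ (b.ext fun k => ?_)))
    change g x (b k) = g y (b k)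
    rw [hb k x, hb k y]
    have : x ∈ A k ↔ y ∈ A k := ⟨fun hx => h k x y hx, fun hy => h k y x hy⟩
    simp only [this]
  obtain ⟨k, x', y', hx', hy'⟩ := hne
  obtain ⟨hle, hW⟩ := Finset.card_le_of_perm_invariant W hWinv (hAW k) hx' hy'
  refine ⟨hle.trans hWcard, fun hcard => ?_⟩
  have hsign : ∃ (s : S) (e : ι → κ), s * s = 1 ∧ Function.Injective e ∧
      ∀ i j, g j (b (e i)) = (s * if i = j then -1 else 1) • b (e i) := by
    have hsurj : ∀ B ∈ W, ∃ k, A k = B := fun B hB => by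
      simpa using hWA hB
    rcases hW (hWcard.trans hcard.le) with h | h
    · choose e he using fun i => hsurj _ (h i)
      refine ⟨1, e, one_mul 1, fun i j hij => ?_, fun i j => ?_⟩
      · have := he i
        rwa [hij, he j, Finset.singleton_inj, eq_comm] at this
      · rw [hb, he]
        simp [eq_comm]
    · choose e he using fun i => hsurj _ (h i)
      refine ⟨-1, e, by ring, fun i j hij => ?_, fun i j => ?_⟩
      · have := he i
        rwa [hij, he j, compl_inj_iff, Finset.singleton_inj, eq_comm] at this
      · rw [hb, he]
        by_cases hij : i = j <;> simp [hij, eq_comm]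
  obtain ⟨s, e, hs, he, hg⟩ := hsign
  let E : ι ≃ κ := Equiv.ofBijective e
    ((Fintype.bijective_iff_injective_and_card e).2 ⟨he, hcard.symm⟩)
  let c : Basis ι S (κ → S) := b.reindex E.symm
  refine ⟨((LinearMap.toMatrixAlgEquiv c : End S (κ → S) ≃ₐ[S] Matrix ι ι S) : _ →* _).comp Φ, s,
    (LinearMap.toMatrixAlgEquiv c).injective.comp hΦ, hs, fun j => ?_⟩
  ext p r
  change LinearMap.toMatrixAlgEquiv c (g j) p r = _
  rw [LinearMap.toMatrixAlgEquiv_apply]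
  have : g j (c r) = (s * if r = j then -1 else 1) • c r := by
    rw [Basis.reindex_apply]; exact hg r j
  rw [this, map_smul, c.repr_self, Matrix.smul_apply, coe_signFlip_apply, Finsupp.smul_apply,
    Finsupp.single_apply]
  by_cases hpr : p = r
  · subst hpr; simp
  · simp [hpr, Ne.symm hpr]

/-- An embedding of general linear groups of the same size at least `3` over local rings in which
`2` is invertible yields an embedding of the rings. -/
theorem exists_injective_ringHom {n : ℕ} (hn : 3 ≤ n) {R S : Type*} [CommRing R] [Nontrivial R]
    [CommRing S] [IsLocalRing S] (h2R : IsUnit (2 : R)) (h2 : IsUnit (2 : S))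
    (ρ : GL (Fin n) R →* GL (Fin n) S) (hρ : Function.Injective ρ) :
    ∃ f : R →+* S, Function.Injective f := by
  have h01 : (⟨0, by omega⟩ : Fin n) ≠ ⟨1, by omega⟩ := by simp
  obtain ⟨ρ', s, hinj, hρ'⟩ := (exists_adaptedToSigns h2R h2 h01 ρ hρ).2 rfl
  exact hρ'.exists_injective_ringHom hinj h2R h2 h01 (k := ⟨2, by omega⟩) (by simp) (by simp)

end Matrix.GeneralLinearGroup

/-! ### Commutativity, and the comparison of universal theories -/

/-- If inverse-transpose is multiplicative on invertible matrices of size at least `3`, the ring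
is commutative: transposing the product of `1 + a e 0 1` and `1 + b e 1 2` in the two possible
ways gives `a * b = b * a`. -/
theorem AdmitsInverseTranspose.mul_comm {n : ℕ} (hn : 3 ≤ n) {R : Type*} [Ring R]
    (h : AdmitsInverseTranspose n R) (a b : R) : a * b = b * a := by
  obtain ⟨φ, hφ⟩ := h
  have hT : ∀ x y : Matrix.GeneralLinearGroup (Fin n) R,
      ((x : Matrix (Fin n) (Fin n) R) * y).transpose =
        (y : Matrix (Fin n) (Fin n) R).transpose * (x : Matrix (Fin n) (Fin n) R).transpose := by
    intro x y
    rw [← hφ x, ← hφ y, ← Units.val_mul, ← Units.val_mul, ← hφ, map_mul, mul_inv_rev]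
  have hunit : ∀ {i j : Fin n} (_ : i ≠ j) (c : R),
      ∃ x : Matrix.GeneralLinearGroup (Fin n) R,
        (x : Matrix (Fin n) (Fin n) R) = 1 + Matrix.single i j c := by
    intro i j hij c
    have hs : Matrix.single i j c * Matrix.single i j c = 0 :=
      Matrix.single_mul_single_of_ne _ _ _ _ hij.symm _
    exact ⟨⟨1 + Matrix.single i j c, 1 - Matrix.single i j c,
      by rw [add_mul, mul_sub, mul_sub, hs]; simp, by rw [sub_mul, mul_add, mul_add, hs]; simp⟩, rfl⟩
  let i : Fin n := ⟨0, by omega⟩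
  let j : Fin n := ⟨1, by omega⟩
  let k : Fin n := ⟨2, by omega⟩
  have hij : i ≠ j := by simp [i, j]
  have hjk : j ≠ k := by simp [j, k]
  have hik : i ≠ k := by simp [i, k]
  obtain ⟨x, hx⟩ := hunit hij a
  obtain ⟨y, hy⟩ := hunit hjk b
  have h1 := Matrix.ext_iff.2 (hT x y) k i
  rw [hx, hy] at h1
  simpa [mul_add, add_mul, hij, hij.symm, hjk, hjk.symm, hik, hik.symm,
    Matrix.single_apply] using h1

/-- Universal equivalence of the general linear groups bounds `n` by `m` and, for `n = m`, embeds
`R` into an ultrapower of `S`; the reverse bound and embedding follow by symmetry. -/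
theorem GroupsUniversallyEquivalent.le_and_exists_ringHom {n m : ℕ} (hn : 3 ≤ n)
    {R : Type u} {S : Type v} [CommRing R] [CommRing S] [IsLocalRing R] [IsLocalRing S]
    (h2R : IsUnit (2 : R)) (h2S : IsUnit (2 : S))
    (h : GroupsUniversallyEquivalent (Matrix.GeneralLinearGroup (Fin n) R)
      (Matrix.GeneralLinearGroup (Fin m) S)) :
    n ≤ m ∧ (n = m → ∃ (I : Type u) (U : Ultrafilter I)
      (f : R →+* Filter.Germ (U : Filter I) S), Function.Injective f) := by
  obtain ⟨I, U, f, hf⟩ := h.exists_injective_germ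
  have := Filter.Germ.isLocalRing (U := U) (S := S)
  have h2 : IsUnit (2 : Filter.Germ (U : Filter I) S) := by
    have := h2S.map ((Filter.Germ.coeRingHom (U : Filter I)).comp (Pi.constRingHom I S))
    rwa [map_ofNat] at this
  let ρ := Filter.Germ.generalLinearGroupEquiv.toMonoidHom.comp f
  have hρ : Function.Injective ρ := Filter.Germ.generalLinearGroupEquiv.injective.comp hf
  refine ⟨?_, ?_⟩
  · have h01 : (⟨0, by omega⟩ : Fin n) ≠ ⟨1, by omega⟩ := by simp
    simpa using (Matrix.GeneralLinearGroup.exists_adaptedToSigns h2R h2 h01 ρ hρ).1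
  · rintro rfl
    exact ⟨I, U, Matrix.GeneralLinearGroup.exists_injective_ringHom hn h2R h2 ρ hρ⟩

theorem groupsUniversallyEquivalent_generalLinearGroup_iff {R₁ R₂ : Type*} [CommRing R₁]
    [CommRing R₂] [IsLocalRing R₁] [IsLocalRing R₂] (h2₁ : IsUnit (2 : R₁))
    (h2₂ : IsUnit (2 : R₂)) (n m : ℕ) (hn : 3 ≤ n) (hm : 3 ≤ m) :
    GroupsUniversallyEquivalent (Matrix.GeneralLinearGroup (Fin n) R₁)
        (Matrix.GeneralLinearGroup (Fin m) R₂) ↔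
      n = m ∧ RingsUniversallyEquivalent R₁ R₂ := by
  constructor
  · intro h
    have h' : GroupsUniversallyEquivalent (Matrix.GeneralLinearGroup (Fin m) R₂)
        (Matrix.GeneralLinearGroup (Fin n) R₁) := fun φ hφ => (h φ hφ).symm
    obtain ⟨hnm, h1⟩ := h.le_and_exists_ringHom hn h2₁ h2₂
    obtain ⟨hmn, h2⟩ := h'.le_and_exists_ringHom hm h2₂ h2₁
    obtain rfl := le_antisymm hnm hmn
    obtain ⟨I, U, f, hf⟩ := h1 rfl
    obtain ⟨J, V, g, hg⟩ := h2 rfl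
    exact ⟨rfl, ringsUniversallyEquivalent_of_injective_germ f hf g hg⟩
  · rintro ⟨rfl, h⟩
    have h' : RingsUniversallyEquivalent R₂ R₁ := fun φ hφ => (h φ hφ).symm
    obtain ⟨I, U, f, hf⟩ := h.exists_injective_germ
    obtain ⟨J, V, g, hg⟩ := h'.exists_injective_germ
    obtain ⟨F, hF⟩ := Filter.Germ.exists_injective_generalLinearGroup (n := Fin n) f hf
    obtain ⟨G, hG⟩ := Filter.Germ.exists_injective_generalLinearGroup (n := Fin n) g hg
    exact groupsUniversallyEquivalent_of_injective_germ F hF G hG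

theorem theorem1 {R₁ R₂ : Type*} [Ring R₁] [Ring R₂] [IsLocalRing R₁] [IsLocalRing R₂]
    (h2₁ : IsUnit (2 : R₁)) (h2₂ : IsUnit (2 : R₂)) (n m : ℕ) (hn : 3 ≤ n) (hm : 3 ≤ m)
    (hT₁ : AdmitsInverseTranspose n R₁) (hT₂ : AdmitsInverseTranspose m R₂) :
    GroupsUniversallyEquivalent (Matrix.GeneralLinearGroup (Fin n) R₁)
        (Matrix.GeneralLinearGroup (Fin m) R₂) ↔
      n = m ∧ RingsUniversallyEquivalent R₁ R₂ := by
  let _ : CommRing R₁ := { ‹Ring R₁› with mul_comm := hT₁.mul_comm hn }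
  let _ : CommRing R₂ := { ‹Ring R₂› with mul_comm := hT₂.mul_comm hm }
  exact groupsUniversallyEquivalent_generalLinearGroup_iff h2₁ h2₂ n m hn hm
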